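/- Let $m,n$ be non-negative integers. For Hermitian matrices $A_1,\dots,A_m\in\mathbb C^{n\times n}$ put $\mathcal M_{\mathcal A}(\mathbf x)=(\langle A_1\mathbf x,\mathbf x\rangle,\dots,\langle A_m\mathbf x,\mathbf x\rangle)\in\mathbb C^m$ for $\mathbf x\in\mathbb C^n$, and let $d(\mathbf x,\mathbf y)=\|\mathbf x\mathbf x^*-\mathbf y\mathbf y^*\|_F$. For $0<a\le b$ the map $\mathcal M_{\mathcal A}$ is called $(a,b)$-stable if $a\,d(\mathbf x,\mathbf y)\le\|\mathcal M_{\mathcal A}(\mathbf x)-\mathcal M_{\mathcal A}(\mathbf y)\|_2\le b\,d(\mathbf x,\mathbf y)$ for all $\mathbf x,\mathbf y\in\mathbb C^n$. Call $A_1,\dots,A_m$ independent complex Hermitian Gaussian random matrices if each $A_k$ is a random Hermitian matrix with diagonal entries distributed as $\mathcal N(0,1)$ and with entries above the diagonal distributed as $\mathcal N(0,\tfrac12)+\mathsf i\,\mathcal N(0,\tfrac12)$ (independent real and imaginary parts), and all the entries on or above the diagonal of all the matrices are jointly independent. **Theorem.** For every $\xi\in(0,1)$ there exist constants $C>0$ and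 $\beta\ge\alpha>0$, depending only on $\xi$, such that for all $n$ and all $m>Cn$, if $A_1,\dots,A_m\in\mathbb C^{n\times n}$ are independent complex Hermitian Gaussian random matrices, then with probability at least $1-\xi$ the map $\mathcal M_{\mathcal A}$ is $(\alpha\sqrt m,\beta\sqrt m)$-stable, that is, for all $\mathbf x,\mathbf y\in\mathbb C^n$ simultaneously, $$\alpha\,d(\mathbf x,\mathbf y)\le\frac1{\sqrt m}\,\|\mathcal M_{\mathcal A}(\mathbf x)-\mathcal M_{\mathcal A}(\mathbf y)\|_2\le\beta\,d(\mathbf x,\mathbf y).$$ -/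

import Mathlib

open MeasureTheory ProbabilityTheory
open scoped NNReal Matrix

noncomputable section

namespace QuadraticFeasibility

/-- The quadratic measurement map `x ↦ (⟨A₁ x, x⟩, …, ⟨A_m x, x⟩)` from `ℂⁿ` to `ℂᵐ`, with
`⟨u, v⟩ = ∑ k, u k * conj (v k)`; the target carries the Euclidean norm. -/
def measurementMap {n m : ℕ} (A : Fin m → Matrix (Fin n) (Fin n) ℂ) (x : Fin n → ℂ) :
    EuclideanSpace ℂ (Fin m) :=
  WithLp.toLp 2 fun i => (A i *ᵥ x) ⬝ᵥ star x

open scoped Matrix.Norms.Frobenius in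
/-- The distance `d(x, y) = ‖x x* - y y*‖_F` (Frobenius norm) between vectors of `ℂⁿ`. -/
def outerDist {n : ℕ} (x y : Fin n → ℂ) : ℝ :=
  ‖Matrix.vecMulVec x (star x) - Matrix.vecMulVec y (star y)‖

/-- `(α, β)`-stability of the measurement map of `A` in the distance `outerDist`. -/
def IsStable {n m : ℕ} (A : Fin m → Matrix (Fin n) (Fin n) ℂ) (α β : ℝ) : Prop :=
  0 < α ∧ α ≤ β ∧ ∀ x y : Fin n → ℂ,
    α * outerDist x y ≤ ‖measurementMap A x - measurementMap A y‖ ∧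
      ‖measurementMap A x - measurementMap A y‖ ≤ β * outerDist x y

/-- The standard real Gaussian distribution `N(0, 1)`, as a distribution on `ℂ`. -/
def realGaussianLaw : Measure ℂ :=
  (gaussianReal 0 1).map (fun t : ℝ => (t : ℂ))

/-- The standard complex Gaussian distribution on `ℂ`: independent real and imaginary parts,
each distributed as `N(0, 1/2)`. -/
def complexGaussianLaw : Measure ℂ :=
  ((gaussianReal 0 (1 / 2)).prod (gaussianReal 0 (1 / 2))).map
    (fun p : ℝ × ℝ => (p.1 : ℂ) + (p.2 : ℂ) * Complex.I)

/-- `A₁, …, A_m` are independent complex Hermitian Gaussian `n × n` random matrices: each is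
Hermitian, the diagonal entries are standard real Gaussian, the entries above the diagonal are
standard complex Gaussian, and all the entries on or above the diagonal, of all the matrices
together, are independent. -/
structure IsHermitianGaussianFamily {n m : ℕ} {Ω : Type*} [MeasurableSpace Ω]
    (A : Fin m → Ω → Matrix (Fin n) (Fin n) ℂ) (μ : Measure Ω) : Prop where
  isHermitian : ∀ k ω, (A k ω).IsHermitian
  hasLaw_diag : ∀ k i, HasLaw (fun ω => A k ω i i) realGaussianLaw μ
  hasLaw_offDiag : ∀ k i j, i < j → HasLaw (fun ω => A k ω i j) complexGaussianLaw μ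
  indep : iIndepFun
    (fun (q : Fin m × {p : Fin n × Fin n // p.1 ≤ p.2}) (ω : Ω) => A q.1 ω q.2.1.1 q.2.1.2) μ

end QuadraticFeasibility

end

open scoped ComplexConjugate

/-! Differences of measurements are linear in `X = xx* - yy*`: their coordinates are `tr (A_k X)`.
For a fixed Hermitian `X` these are independent `N(0, ‖X‖²)` variables (`traceRe_gaussian`), so the
sum of their squares is a scaled chi-square and lies between `m‖X‖²/9` and `4m‖X‖²` outside an event
of probability at most `2 exp(-m/2)`.

Uniformity in `x, y` comes from polarization: `X = (zw* + wz*)/2` with `z = x + θy`, `w = x - θy`,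
where the phase `θ` makes `⟨z, w⟩` real (`exists_outerDiff_eq_symmOuter`). There is then no
cancellation, and `‖z‖‖w‖` is at most `10/7 * ‖X‖`. Bounds for `z, w` in a net of the unit ball of
`ℂⁿ` therefore extend by bilinearity to every `X` of this kind (`norm_bounds_of_net`). The net
yields at most `129 ^ (4n)` pairs, a number that `exp(-m/2)` beats once `m > Cn`. -/

namespace QuadraticFeasibility

/-! ### Volumetric bound for nets of the unit ball. -/

section Net

variable {E : Type*} [NormedAddCommGroup E] [NormedSpace ℝ E] [FiniteDimensional ℝ E]

open Metric Module in
/-- An `ε`-separated finite subset of the unit ball has at most `(1 + 2 / ε) ^ dim` elements. -/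
theorem card_le_of_separated_unitBall {ε : ℝ} (hε : 0 < ε) (s : Finset E)
    (hs : ∀ c ∈ s, ‖c‖ ≤ 1) (h : ∀ c ∈ s, ∀ d ∈ s, c ≠ d → ε ≤ ‖c - d‖) :
    (s.card : ℝ) ≤ (1 + 2 / ε) ^ finrank ℝ E := by
  borelize E
  let μ : Measure E := Measure.addHaar
  have δpos : 0 < ε / 2 := by positivity
  have ρpos : 0 < 1 + ε / 2 := by positivity
  set A := ⋃ c ∈ s, ball (c : E) (ε / 2) with hA
  have D : Set.Pairwise (s : Set E) (Function.onFun Disjoint fun c => ball (c : E) (ε / 2)) := by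
    rintro c hc d hd hcd
    apply ball_disjoint_ball
    rw [dist_eq_norm]
    linarith [h c hc d hd hcd]
  have A_subset : A ⊆ ball (0 : E) (1 + ε / 2) := by
    refine Set.iUnion₂_subset fun x hx => ball_subset_ball' ?_
    rw [dist_zero_right]
    linarith [hs x hx]
  have I : (s.card : ENNReal) * ENNReal.ofReal ((ε / 2) ^ finrank ℝ E) * μ (ball 0 1) ≤
      ENNReal.ofReal ((1 + ε / 2) ^ finrank ℝ E) * μ (ball 0 1) :=
    calc
      _ = μ A := by
        rw [hA, measure_biUnion_finset D fun c _ => measurableSet_ball]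
        simp only [μ.addHaar_ball_of_pos _ δpos]
        simp only [Finset.sum_const, nsmul_eq_mul, mul_assoc]
      _ ≤ μ (ball (0 : E) (1 + ε / 2)) := measure_mono A_subset
      _ = _ := by simp only [μ.addHaar_ball_of_pos _ ρpos]
  have J := (ENNReal.mul_le_mul_iff_left (measure_ball_pos _ _ zero_lt_one).ne'
    measure_ball_lt_top.ne).1 I
  have K : (s.card : ℝ) * (ε / 2) ^ finrank ℝ E ≤ (1 + ε / 2) ^ finrank ℝ E := by
    have := ENNReal.toReal_le_of_le_ofReal (by positivity) J
    rwa [ENNReal.toReal_mul, ENNReal.toReal_natCast, ENNReal.toReal_ofReal (by positivity)] at this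
  rw [← le_div_iff₀ (by positivity), ← div_pow] at K
  have e : (1 + ε / 2) / (ε / 2) = 1 + 2 / ε := by field_simp; ring
  rwa [e] at K

open Metric Module in
/-- The unit ball has an `ε`-net with at most `(1 + 2 / ε) ^ dim` elements. -/
theorem exists_finset_net_unitBall {ε : ℝ} (hε : 0 < ε) :
    ∃ s : Finset E, (∀ x ∈ s, ‖x‖ ≤ 1) ∧ (∀ x : E, ‖x‖ ≤ 1 → ∃ y ∈ s, ‖x - y‖ ≤ ε) ∧
      (s.card : ℝ) ≤ (1 + 2 / ε) ^ finrank ℝ E := by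
  classical
  let P : Finset E → Prop := fun s =>
    (∀ c ∈ s, ‖c‖ ≤ 1) ∧ ∀ c ∈ s, ∀ d ∈ s, c ≠ d → ε ≤ ‖c - d‖
  let N : Set ℕ := {k | ∃ s, P s ∧ s.card = k}
  have hb : BddAbove N := by
    refine ⟨⌊(1 + 2 / ε) ^ finrank ℝ E⌋₊, ?_⟩
    rintro _ ⟨s, hs, rfl⟩
    exact Nat.le_floor (card_le_of_separated_unitBall hε s hs.1 hs.2)
  have hne : N.Nonempty := ⟨0, ∅, by simp [P], rfl⟩
  -- A separated set of maximal cardinality is a net: a point far from it could be added.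
  obtain ⟨s, hs, hcard⟩ := Nat.sSup_mem hne hb
  refine ⟨s, hs.1, fun x hx => ?_, card_le_of_separated_unitBall hε s hs.1 hs.2⟩
  by_contra! hfar
  have hxs : x ∉ s := fun hxs => by simpa using (hfar x hxs).le.trans_lt' hε
  have hP : P (insert x s) := by
    refine ⟨by simpa using ⟨hx, hs.1⟩, ?_⟩
    intro c hc d hd hcd
    rw [Finset.mem_insert] at hc hd
    rcases hc with rfl | hc <;> rcases hd with rfl | hd
    · exact absurd rfl hcd
    · exact (hfar d hd).le
    · rw [norm_sub_rev]; exact (hfar c hc).le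
    · exact hs.2 c hc d hd hcd
  have := le_csSup hb ⟨insert x s, hP, rfl⟩
  rw [Finset.card_insert_of_notMem hxs, hcard] at this
  omega

end Net

/-! ### Passing from a net to all vectors for bilinear maps. -/

section Bilinear

variable {E V F : Type*} [NormedAddCommGroup E] [NormedSpace ℝ E] [NormedAddCommGroup V]
  [NormedSpace ℝ V] [NormedAddCommGroup F] [NormedSpace ℝ F]

/-- Variation of a bilinear map between points of the unit ball. -/
theorem norm_bilin_sub_le (T : E →L[ℝ] E →L[ℝ] F) {z w u v : E} {ε : ℝ} (hw : ‖w‖ ≤ 1)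
    (hu : ‖u‖ ≤ 1) (hzu : ‖z - u‖ ≤ ε) (hwv : ‖w - v‖ ≤ ε) :
    ‖T z w - T u v‖ ≤ 2 * ε * ‖T‖ := by
  have hε : 0 ≤ ε := (norm_nonneg _).trans hzu
  have h1 : T z w - T u v = T (z - u) w + T u (w - v) := by simp
  rw [h1]
  have h2 : ‖T (z - u) w‖ ≤ ‖T‖ * ε * 1 := (T.le_opNorm₂ _ _).trans (by gcongr)
  have h3 : ‖T u (w - v)‖ ≤ ‖T‖ * 1 * ε := (T.le_opNorm₂ _ _).trans (by gcongr)
  linarith [norm_add_le (T (z - u) w) (T u (w - v))]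

theorem norm_bilin_eq_unit (T : E →L[ℝ] E →L[ℝ] F) {z w : E} (hz : z ≠ 0) (hw : w ≠ 0) :
    ‖T z w‖ = ‖T (‖z‖⁻¹ • z) (‖w‖⁻¹ • w)‖ * (‖z‖ * ‖w‖) := by
  have hz' : ‖z‖ ≠ 0 := norm_ne_zero_iff.2 hz
  have hw' : ‖w‖ ≠ 0 := norm_ne_zero_iff.2 hw
  simp only [map_smul, _root_.smul_apply, norm_smul, norm_inv, norm_norm]
  field_simp

/-- Moving both arguments to the net costs `2ε‖T‖`, at most `‖T‖ / 2`, which is absorbed on the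
left. -/
theorem norm_bilin_le_of_net (T : E →L[ℝ] E →L[ℝ] F) {s : Finset E} {ε K : ℝ} (hε : ε ≤ 1 / 4)
    (hK : 0 ≤ K) (hs : ∀ x ∈ s, ‖x‖ ≤ 1) (hnet : ∀ x : E, ‖x‖ ≤ 1 → ∃ y ∈ s, ‖x - y‖ ≤ ε)
    (h : ∀ u ∈ s, ∀ v ∈ s, ‖T u v‖ ≤ K) : ‖T‖ ≤ 2 * K := by
  have hε0 : 0 ≤ ε := by
    obtain ⟨y, -, hy⟩ := hnet 0 (by simp)
    exact (norm_nonneg _).trans hy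
  have key : ∀ z w : E, ‖z‖ ≤ 1 → ‖w‖ ≤ 1 → ‖T z w‖ ≤ K + 2 * ε * ‖T‖ := by
    intro z w hz hw
    obtain ⟨u, hu, hzu⟩ := hnet z hz
    obtain ⟨v, hv, hwv⟩ := hnet w hw
    have h1 := norm_bilin_sub_le T hw (hs u hu) hzu hwv
    have h2 := norm_sub_norm_le (T z w) (T u v)
    linarith [h u hu v hv]
  have hle : ‖T‖ ≤ K + 2 * ε * ‖T‖ := by
    refine T.opNorm_le_bound₂ (by positivity) fun z w => ?_
    rcases eq_or_ne z 0 with rfl | hz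
    · simp
    rcases eq_or_ne w 0 with rfl | hw
    · simp
    rw [norm_bilin_eq_unit T hz hw, mul_assoc]
    gcongr
    exact key _ _ (norm_smul_inv_norm (𝕜 := ℝ) hz).le (norm_smul_inv_norm (𝕜 := ℝ) hw).le
  nlinarith [norm_nonneg T]

/-- Two-sided bounds for `L ∘ H` on pairs of points of a `1 / 64`-net extend to all pairs. -/
theorem norm_bounds_of_net (H : E →L[ℝ] E →L[ℝ] V) (hH : ‖H‖ ≤ 1) (L : V →L[ℝ] F)
    {s : Finset E} {r : ℝ} (hr : 0 ≤ r)
    (hs : ∀ x ∈ s, ‖x‖ ≤ 1) (hnet : ∀ x : E, ‖x‖ ≤ 1 → ∃ y ∈ s, ‖x - y‖ ≤ 1 / 64)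
    (h : ∀ u ∈ s, ∀ v ∈ s, r / 3 * ‖H u v‖ ≤ ‖L (H u v)‖ ∧ ‖L (H u v)‖ ≤ 2 * r * ‖H u v‖)
    (z w : E) (hzw : ‖z‖ * ‖w‖ ≤ 10 / 7 * ‖H z w‖) :
    r / 20 * ‖H z w‖ ≤ ‖L (H z w)‖ ∧ ‖L (H z w)‖ ≤ 6 * r * ‖H z w‖ := by
  let T : E →L[ℝ] E →L[ℝ] F := (ContinuousLinearMap.compL ℝ E V F L).comp H
  have hT : ∀ z w, T z w = L (H z w) := fun z w => rfl
  -- This a priori bound also controls the approximation error in the lower estimate.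
  have hTn : ‖T‖ ≤ 2 * (2 * r) := by
    refine norm_bilin_le_of_net T (by norm_num) (by positivity) hs hnet fun u hu v hv => ?_
    have h1 : ‖H u v‖ ≤ 1 := by
      calc ‖H u v‖ ≤ ‖H‖ * ‖u‖ * ‖v‖ := H.le_opNorm₂ u v
        _ ≤ 1 * 1 * 1 := by gcongr; exacts [hs u hu, hs v hv]
        _ = 1 := by norm_num
    rw [hT]
    nlinarith [(h u hu v hv).2]
  rcases eq_or_ne z 0 with rfl | hz
  · simp
  rcases eq_or_ne w 0 with rfl | hw
  · simp
  have hz0 := norm_pos_iff.2 hz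
  have hw0 := norm_pos_iff.2 hw
  have hp : 0 < ‖z‖ * ‖w‖ := mul_pos hz0 hw0
  have hHle : ‖H z w‖ ≤ ‖z‖ * ‖w‖ := by
    calc ‖H z w‖ ≤ ‖H‖ * ‖z‖ * ‖w‖ := H.le_opNorm₂ z w
      _ ≤ 1 * ‖z‖ * ‖w‖ := by gcongr
      _ = _ := by rw [one_mul]
  constructor
  · set z' := ‖z‖⁻¹ • z
    set w' := ‖w‖⁻¹ • w
    have hz' : ‖z'‖ ≤ 1 := (norm_smul_inv_norm (𝕜 := ℝ) hz).le
    have hw' : ‖w'‖ ≤ 1 := (norm_smul_inv_norm (𝕜 := ℝ) hw).le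
    have eH := norm_bilin_eq_unit H hz hw
    have eT := norm_bilin_eq_unit T hz hw
    rw [hT, hT] at eT
    obtain ⟨u, hu, hzu⟩ := hnet z' hz'
    obtain ⟨v, hv, hwv⟩ := hnet w' hw'
    have h1 := norm_bilin_sub_le T hw' (hs u hu) hzu hwv
    have h2 := norm_bilin_sub_le H hw' (hs u hu) hzu hwv
    have h3 := norm_sub_norm_le (H z' w') (H u v)
    have h4 := norm_sub_norm_le (T u v) (T z' w')
    rw [norm_sub_rev, hT, hT] at h4
    rw [hT, hT] at h1
    have h5 : 7 / 10 ≤ ‖H z' w'‖ := by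
      rw [eH] at hzw
      by_contra! hlt
      nlinarith
    have h6 : 7 / 10 - 1 / 32 ≤ ‖H u v‖ := by linarith
    have h7 : r / 3 * (7 / 10 - 1 / 32) ≤ ‖L (H u v)‖ :=
      le_trans (by gcongr) (h u hu v hv).1
    -- The error is at most `2 * (1/64) * 4r = r/8`, while `h7` gives more than `0.22 r`.
    have h8 : r / 20 ≤ ‖L (H z' w')‖ := by linarith
    calc r / 20 * ‖H z w‖ ≤ r / 20 * (‖z‖ * ‖w‖) := by gcongr
      _ ≤ ‖L (H z' w')‖ * (‖z‖ * ‖w‖) := by gcongr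
      _ = _ := eT.symm
  · calc ‖L (H z w)‖ = ‖T z w‖ := by rw [hT]
      _ ≤ ‖T‖ * ‖z‖ * ‖w‖ := T.le_opNorm₂ z w
      _ ≤ 2 * (2 * r) * ‖z‖ * ‖w‖ := by gcongr
      _ = 4 * r * (‖z‖ * ‖w‖) := by ring
      _ ≤ 4 * r * (10 / 7 * ‖H z w‖) := by gcongr
      _ ≤ _ := by nlinarith [mul_nonneg hr (norm_nonneg (H z w))]

end Bilinear

/-! ### Chernoff bounds for chi-square variables. -/

section ChiSquare

/-- The moment generating function of the square of a centred Gaussian. -/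
theorem integral_exp_mul_sq_gaussianReal {v : ℝ≥0} (hv : v ≠ 0) {t : ℝ} (ht : t < 1 / 2) :
    ∫ x, Real.exp (t / v * x ^ 2) ∂(gaussianReal 0 v) = (√(1 - 2 * t))⁻¹ := by
  have hv' : (0 : ℝ) < v := by positivity
  rw [integral_gaussianReal_eq_integral_smul hv]
  have h1 : ∀ x : ℝ, gaussianPDFReal 0 v x • Real.exp (t / v * x ^ 2)
      = (√(2 * Real.pi * v))⁻¹ * Real.exp (-((1 - 2 * t) / (2 * v)) * x ^ 2) := by
    intro x
    rw [gaussianPDFReal, smul_eq_mul, mul_assoc, ← Real.exp_add]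
    congr 2
    field_simp
    ring
  simp_rw [h1]
  rw [integral_const_mul, integral_gaussian, ← Real.sqrt_inv, ← Real.sqrt_inv,
    ← Real.sqrt_mul (by positivity)]
  congr 1
  have : 1 - 2 * t ≠ 0 := by linarith
  field_simp

variable {Ω : Type*} [MeasurableSpace Ω] {μ : Measure Ω} {m : ℕ} {Z : Fin m → Ω → ℝ} {v : ℝ≥0}

theorem mgf_sq_gaussian {X : Ω → ℝ} (hX : HasLaw X (gaussianReal 0 v) μ) (hv : v ≠ 0) {t : ℝ}
    (ht : t < 1 / 2) : mgf (fun ω => X ω ^ 2) μ (t / v) = (√(1 - 2 * t))⁻¹ := by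
  rw [← integral_exp_mul_sq_gaussianReal hv ht]
  exact hX.integral_comp (f := fun x => Real.exp (t / v * x ^ 2)) (by fun_prop)

theorem mgf_sum_sq_gaussian (hZ : iIndepFun Z μ) (hlaw : ∀ k, HasLaw (Z k) (gaussianReal 0 v) μ)
    (hv : v ≠ 0) {t : ℝ} (ht : t < 1 / 2) :
    mgf (fun ω => ∑ k, Z k ω ^ 2) μ (t / v) = ((√(1 - 2 * t))⁻¹) ^ m := by
  have h1 : iIndepFun (fun k ω => Z k ω ^ 2) μ :=
    hZ.comp (fun _ x => x ^ 2) (fun _ => by fun_prop)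
  have h2 := h1.mgf_sum₀ (t := t / v) (fun k => (hlaw k).aemeasurable.pow_const 2) Finset.univ
  have h3 : (fun ω => ∑ k, Z k ω ^ 2) = ∑ k, fun ω => Z k ω ^ 2 := by ext; simp
  rw [h3, h2]
  simp [fun k => mgf_sq_gaussian (hlaw k) hv ht]

theorem integrable_exp_sum_sq_gaussian (hZ : iIndepFun Z μ)
    (hlaw : ∀ k, HasLaw (Z k) (gaussianReal 0 v) μ) (hv : v ≠ 0) {t : ℝ} (ht : t < 1 / 2) :
    Integrable (fun ω => Real.exp (t / v * ∑ k, Z k ω ^ 2)) μ := by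
  -- The Bochner integral of a non-integrable function is `0`, so a nonzero value proves
  -- integrability.
  refine Integrable.of_integral_ne_zero ?_
  have h := mgf_sum_sq_gaussian hZ hlaw hv ht
  rw [mgf] at h
  rw [h]
  have : 0 < 1 - 2 * t := by linarith
  positivity

/-- Upper tail of a scaled chi-square variable. -/
theorem measureReal_sum_sq_ge_le (hZ : iIndepFun Z μ)
    (hlaw : ∀ k, HasLaw (Z k) (gaussianReal 0 v) μ) (hv : v ≠ 0) :
    μ.real {ω | 4 * v * m ≤ ∑ k, Z k ω ^ 2} ≤ Real.exp (-1 / 2) ^ m := by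
  have := hZ.isProbabilityMeasure
  have hv' : (0 : ℝ) < v := by positivity
  -- At `t = 1/4` each factor is `exp(-1) * √2`, at most `exp(-1/2)` because `2 ≤ e`.
  have ht : (1 / 4 : ℝ) < 1 / 2 := by norm_num
  refine (measure_ge_le_exp_mul_mgf (4 * v * m : ℝ) (t := 1 / 4 / v) (by positivity)
    (integrable_exp_sum_sq_gaussian hZ hlaw hv ht)).trans ?_
  rw [mgf_sum_sq_gaussian hZ hlaw hv ht]
  have h1 : Real.exp (-(1 / 4 / v) * (4 * v * m)) = Real.exp (-1) ^ m := by
    rw [← Real.exp_nat_mul]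
    congr 1
    field_simp
  rw [h1, ← mul_pow]
  gcongr
  have h0 : Real.exp (-1) = Real.exp (-1 / 2) * Real.exp (-1 / 2) := by
    rw [← Real.exp_add]; norm_num
  rw [h0, mul_assoc]
  refine mul_le_of_le_one_right (Real.exp_pos _).le ?_
  rw [← div_eq_mul_inv, div_le_one (by norm_num)]
  refine Real.le_sqrt_of_sq_le ?_
  rw [← Real.exp_nat_mul]
  have h2 : Real.exp ((2 : ℕ) * (-1 / 2)) = (Real.exp 1)⁻¹ := by rw [← Real.exp_neg]; norm_num
  rw [h2, inv_le_comm₀ (Real.exp_pos 1) (by norm_num)]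
  linarith [Real.exp_one_gt_d9]

/-- Lower tail of a scaled chi-square variable. -/
theorem measureReal_sum_sq_le_le (hZ : iIndepFun Z μ)
    (hlaw : ∀ k, HasLaw (Z k) (gaussianReal 0 v) μ) (hv : v ≠ 0) :
    μ.real {ω | ∑ k, Z k ω ^ 2 ≤ v * m / 9} ≤ Real.exp (-1 / 2) ^ m := by
  have := hZ.isProbabilityMeasure
  have hv' : (0 : ℝ) < v := by positivity
  -- At `t = -4` the square root equals `3`, and each factor is `exp(4/9) / 3`, at most `exp(-1/2)`
  -- because `e < 3`.
  have ht : (-4 : ℝ) < 1 / 2 := by norm_num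
  refine (measure_le_le_exp_mul_mgf (v * m / 9 : ℝ) (t := -4 / v)
    (div_nonpos_of_nonpos_of_nonneg (by norm_num) hv'.le)
    (integrable_exp_sum_sq_gaussian hZ hlaw hv ht)).trans ?_
  rw [mgf_sum_sq_gaussian hZ hlaw hv ht]
  have h1 : Real.exp (-(-4 / v) * (v * m / 9)) = Real.exp (4 / 9) ^ m := by
    rw [← Real.exp_nat_mul]
    congr 1
    field_simp
  rw [h1, ← mul_pow]
  gcongr
  have h2 : √(1 - 2 * (-4) : ℝ) = 3 := by
    rw [show (1 - 2 * (-4) : ℝ) = 3 ^ 2 by norm_num, Real.sqrt_sq (by norm_num)]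
  rw [h2, ← div_eq_mul_inv, div_le_iff₀ (by norm_num)]
  have h3 : Real.exp (4 / 9) = Real.exp (-1 / 2) * Real.exp (17 / 18) := by
    rw [← Real.exp_add]; norm_num
  rw [h3]
  gcongr
  have h4 : Real.exp (17 / 18) ≤ Real.exp 1 := Real.exp_le_exp.2 (by norm_num)
  linarith [Real.exp_one_lt_d9]

end ChiSquare

/-! ### Sums of independent Gaussians. -/

section GaussianSums

variable {Ω : Type*} [MeasurableSpace Ω] {μ : Measure Ω}

/-- A finite sum of independent centred Gaussians is a centred Gaussian. -/
theorem hasLaw_sum_gaussianReal {ι : Type*} [Fintype ι] {W : ι → Ω → ℝ} {v : ι → ℝ≥0}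
    (hW : iIndepFun W μ) (hlaw : ∀ i, HasLaw (W i) (gaussianReal 0 (v i)) μ) :
    HasLaw (fun ω => ∑ i, W i ω) (gaussianReal 0 (∑ i, v i)) μ := by
  have := hW.isProbabilityMeasure
  have hm := fun i => (hlaw i).aemeasurable
  have hs : AEMeasurable (fun ω => ∑ i, W i ω) μ :=
    Finset.aemeasurable_fun_sum _ fun i _ => hm i
  have := Measure.isProbabilityMeasure_map hs
  refine ⟨hs, Measure.ext_of_charFun ?_⟩
  rw [hW.charFun_map_fun_sum_eq_prod hm]
  ext t
  simp only [Finset.prod_apply, (hlaw _).map_eq, charFun_gaussianReal, ← Complex.exp_sum]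
  congr 1
  push_cast
  simp [Finset.sum_mul, Finset.sum_div]

/-- Sums over disjoint rows of a matrix of independent Gaussians are independent. -/
theorem iIndepFun_row_sums {κ ι : Type*} [Fintype κ] [Fintype ι] {W : κ × ι → Ω → ℝ}
    (hW : iIndepFun W μ) (hg : ∀ q, HasGaussianLaw (W q) μ) :
    iIndepFun (fun k ω => ∑ i, W (k, i) ω) μ := by
  classical
  have := hW.isProbabilityMeasure
  have hj := hW.hasGaussianLaw hg
  -- The row sums are a linear image of a Gaussian vector, hence jointly Gaussian, so vanishing
  -- covariances suffice.
  let S : (κ × ι → ℝ) →L[ℝ] (κ → ℝ) :=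
    ContinuousLinearMap.pi fun k => ∑ i, ContinuousLinearMap.proj (k, i)
  have hS := hj.map_fun S
  have hS' : HasGaussianLaw (fun ω => ((fun k ω => ∑ i, W (k, i) ω) · ω)) μ := by
    convert! hS using 1
    ext ω k
    simp [S]
  refine hS'.iIndepFun_of_covariance_eq_zero fun k l hkl => ?_
  rw [covariance_fun_sum_fun_sum (fun i => (hg _).memLp_two) (fun i => (hg _).memLp_two)]
  refine Finset.sum_eq_zero fun i _ => Finset.sum_eq_zero fun j _ => ?_
  exact (hW.indepFun (by simp [hkl])).covariance_eq_zero (hg _).memLp_two (hg _).memLp_two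

end GaussianSums

/-! ### Polarization of `xx* - yy*`. -/

section HermitianOuter

variable {n : ℕ}

/-- The polarized outer product `(z w* + w z*) / 2`, as a vector of entries. -/
noncomputable def symmOuter (z w : EuclideanSpace ℂ (Fin n)) : EuclideanSpace ℂ (Fin n × Fin n) :=
  WithLp.toLp 2 fun p => (z p.1 * conj (w p.2) + w p.1 * conj (z p.2)) / 2

theorem norm_sq_symmOuter (z w : EuclideanSpace ℂ (Fin n)) :
    ‖symmOuter z w‖ ^ 2 = (‖z‖ ^ 2 * ‖w‖ ^ 2 + ((∑ i, z i * conj (w i)) ^ 2).re) / 2 := by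
  have h1 : ∀ i j : Fin n, ‖(z i * conj (w j) + w i * conj (z j)) / 2‖ ^ 2
      = (‖z i‖ ^ 2 * ‖w j‖ ^ 2 + ‖w i‖ ^ 2 * ‖z j‖ ^ 2
        + 2 * ((z i * conj (w i)) * (z j * conj (w j))).re) / 4 := by
    intro i j
    simp only [← Complex.normSq_eq_norm_sq, Complex.normSq_apply, Complex.add_re, Complex.add_im,
      Complex.mul_re, Complex.mul_im, Complex.conj_re, Complex.conj_im, Complex.div_ofNat_re,
      Complex.div_ofNat_im]
    ring
  rw [EuclideanSpace.norm_sq_eq, Fintype.sum_prod_type, EuclideanSpace.norm_sq_eq,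
    EuclideanSpace.norm_sq_eq, sq (∑ i, z i * conj (w i))]
  simp only [symmOuter, h1, ← Complex.re_sum, ← Finset.sum_div, Finset.sum_add_distrib,
    ← Finset.mul_sum, ← Finset.sum_mul]
  ring

theorem norm_symmOuter_le (z w : EuclideanSpace ℂ (Fin n)) :
    ‖symmOuter z w‖ ≤ ‖z‖ * ‖w‖ := by
  refine le_of_sq_le_sq ?_ (by positivity)
  rw [norm_sq_symmOuter]
  have h1 : ((∑ i, z i * conj (w i)) ^ 2).re ≤ (‖z‖ * ‖w‖) ^ 2 := by
    refine (Complex.re_le_norm _).trans ?_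
    rw [norm_pow]
    gcongr
    have h2 : ∑ i, z i * conj (w i) = inner ℂ w z := by simp [PiLp.inner_apply]
    rw [h2, mul_comm]
    exact norm_inner_le_norm w z
  nlinarith

/-- `symmOuter` as a continuous real-bilinear map. -/
noncomputable def symmOuterL (n : ℕ) : EuclideanSpace ℂ (Fin n) →L[ℝ] EuclideanSpace ℂ (Fin n) →L[ℝ]
    EuclideanSpace ℂ (Fin n × Fin n) :=
  LinearMap.mkContinuous₂ (LinearMap.mk₂ ℝ symmOuter
    (fun a b c => by ext p; simp [symmOuter]; ring)
    (fun a b c => by ext p; simp [symmOuter]; ring)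
    (fun a b c => by ext p; simp [symmOuter]; ring)
    (fun a b c => by ext p; simp [symmOuter]; ring)) 1
    (fun z w => by simpa using norm_symmOuter_le z w)

@[simp]
theorem symmOuterL_apply (z w : EuclideanSpace ℂ (Fin n)) : symmOuterL n z w = symmOuter z w := rfl

theorem norm_symmOuterL_le : ‖symmOuterL n‖ ≤ 1 :=
  LinearMap.mkContinuous₂_norm_le _ zero_le_one _

theorem symmOuter_conj (z w : EuclideanSpace ℂ (Fin n)) (i j : Fin n) :
    symmOuter z w (j, i) = conj (symmOuter z w (i, j)) := by
  simp [symmOuter, Complex.conj_ofNat]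
  ring

/-- A real inner product has a nonnegative square, so the second term of `norm_sq_symmOuter` can be
dropped; `10/7` is a rational bound for `√2`. -/
theorem mul_norm_le_of_im_eq_zero {z w : EuclideanSpace ℂ (Fin n)}
    (h : (∑ i, z i * conj (w i)).im = 0) : ‖z‖ * ‖w‖ ≤ 10 / 7 * ‖symmOuter z w‖ := by
  refine le_of_sq_le_sq ?_ (by positivity)
  rw [mul_pow, mul_pow, norm_sq_symmOuter, sq (∑ i, z i * conj (w i)), Complex.mul_re, h]
  nlinarith [mul_self_nonneg (∑ i, z i * conj (w i)).re, sq_nonneg (‖z‖ * ‖w‖)]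

/-- The entries of `x x* - y y*`. -/
noncomputable def outerDiff (x y : Fin n → ℂ) : EuclideanSpace ℂ (Fin n × Fin n) :=
  WithLp.toLp 2 fun p => x p.1 * conj (x p.2) - y p.1 * conj (y p.2)

/-- `x x* - y y*` is a polarized outer product of vectors with real inner product. -/
theorem exists_outerDiff_eq_symmOuter (x y : Fin n → ℂ) :
    ∃ z w : EuclideanSpace ℂ (Fin n), outerDiff x y = symmOuter z w ∧
      ‖z‖ * ‖w‖ ≤ 10 / 7 * ‖symmOuter z w‖ := by
  set S : ℂ := ∑ i, x i * conj (y i) with hS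
  -- Replacing `y` by `θy` leaves `yy*` unchanged and makes `⟨x, θy⟩ = ‖S‖` real; then `⟨x + θy, x -
  -- θy⟩` is real too. For `S = 0` any unimodular `θ` works.
  set θ : ℂ := Complex.exp (S.arg * Complex.I) with hθ
  have hθ1 : θ * conj θ = 1 := by
    rw [Complex.mul_conj, Complex.normSq_eq_norm_sq, hθ, Complex.norm_exp_ofReal_mul_I]
    simp
  have hSθ : S * conj θ = (‖S‖ : ℂ) := by
    conv_lhs => rw [← Complex.norm_mul_exp_arg_mul_I S]
    rw [mul_assoc, ← hθ, hθ1, mul_one]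
  refine ⟨WithLp.toLp 2 fun i => x i + θ * y i, WithLp.toLp 2 fun i => x i - θ * y i, ?_, ?_⟩
  · ext p
    simp only [outerDiff, symmOuter, map_add, map_sub, map_mul]
    linear_combination (- y p.1 * conj (y p.2)) * (-hθ1)
  · apply mul_norm_le_of_im_eq_zero
    have h1 : ∀ i, ((x i + θ * y i) * conj (x i - θ * y i)).im
        = -2 * (x i * conj (y i) * conj θ).im := by
      intro i
      simp only [Complex.add_re, Complex.add_im, Complex.sub_re, Complex.sub_im,
        Complex.mul_re, Complex.mul_im, Complex.conj_re, Complex.conj_im]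
      ring
    simp only [Complex.im_sum, h1]
    rw [← Finset.mul_sum, ← Complex.im_sum, ← Finset.sum_mul, ← hS, hSθ]
    simp

open scoped Matrix.Norms.Frobenius in
theorem outerDist_eq_norm (x y : Fin n → ℂ) : outerDist x y = ‖outerDiff x y‖ := by
  rw [outerDist, Matrix.frobenius_norm_def, EuclideanSpace.norm_eq, Real.sqrt_eq_rpow,
    Fintype.sum_prod_type]
  simp [outerDiff, Matrix.vecMulVec_apply]

end HermitianOuter

/-! ### Measurements as a linear map on Hermitian matrices. -/

section TraceMap

variable {n m : ℕ}

/-- The real part of `tr (A X)`, for `X` given by its entries. -/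
noncomputable def traceRe (A : Matrix (Fin n) (Fin n) ℂ) (X : EuclideanSpace ℂ (Fin n × Fin n)) :
    ℝ :=
  ∑ i, ∑ j, (A i j * X (j, i)).re

/-- The linear map `X ↦ (Re tr (A₁ X), …, Re tr (A_m X))`. -/
noncomputable def traceMap (A : Fin m → Matrix (Fin n) (Fin n) ℂ) :
    EuclideanSpace ℂ (Fin n × Fin n) →L[ℝ] EuclideanSpace ℝ (Fin m) :=
  LinearMap.toContinuousLinearMap
    { toFun := fun X => WithLp.toLp 2 fun k => traceRe (A k) X
      map_add' := fun X Y => by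
        ext k
        simp [traceRe, mul_add, Finset.sum_add_distrib]
      map_smul' := fun c X => by
        ext k
        simp only [traceRe, PiLp.smul_apply, RingHom.id_apply, smul_eq_mul, Finset.mul_sum,
          Complex.real_smul]
        refine Finset.sum_congr rfl fun i _ => Finset.sum_congr rfl fun j _ => ?_
        rw [mul_left_comm, Complex.re_ofReal_mul] }

theorem traceMap_apply (A : Fin m → Matrix (Fin n) (Fin n) ℂ)
    (X : EuclideanSpace ℂ (Fin n × Fin n)) (k : Fin m) : traceMap A X k = traceRe (A k) X := rfl

theorem norm_sq_traceMap (A : Fin m → Matrix (Fin n) (Fin n) ℂ)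
    (X : EuclideanSpace ℂ (Fin n × Fin n)) : ‖traceMap A X‖ ^ 2 = ∑ k, traceRe (A k) X ^ 2 := by
  simp [EuclideanSpace.norm_sq_eq, traceMap_apply]

/-- Each coordinate is `tr (A_k (xx* - yy*))`, which is real as a trace of a product of two
Hermitian matrices; taking real parts loses nothing. -/
theorem norm_measurementMap_sub {A : Fin m → Matrix (Fin n) (Fin n) ℂ}
    (hA : ∀ k, (A k).IsHermitian) (x y : Fin n → ℂ) :
    ‖measurementMap A x - measurementMap A y‖ = ‖traceMap A (outerDiff x y)‖ := by
  rw [EuclideanSpace.norm_eq, EuclideanSpace.norm_eq]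
  congr 1
  refine Finset.sum_congr rfl fun k _ => ?_
  congr 1
  set S : ℂ := ∑ i, ∑ j, A k i j * outerDiff x y (j, i) with hS
  have h1 : (measurementMap A x - measurementMap A y) k = S := by
    simp only [measurementMap, PiLp.sub_apply, dotProduct, Matrix.mulVec, hS, outerDiff,
      Finset.sum_mul, ← Finset.sum_sub_distrib, Pi.star_apply, RCLike.star_def]
    refine Finset.sum_congr rfl fun i _ => Finset.sum_congr rfl fun j _ => ?_
    ring
  have h2 : conj S = S := by
    rw [hS, map_sum]
    simp only [map_sum, map_mul]
    rw [Finset.sum_comm]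
    refine Finset.sum_congr rfl fun i _ => Finset.sum_congr rfl fun j _ => ?_
    have h3 : conj (A k j i) = A k i j := (hA k).apply i j
    rw [h3]
    simp only [outerDiff, map_sub, map_mul, Complex.conj_conj]
    ring
  have h4 : traceMap A (outerDiff x y) k = S.re := by
    rw [traceMap_apply, traceRe, hS, Complex.re_sum]
    simp only [Complex.re_sum]
  rw [h1, h4, ← Complex.conj_eq_iff_re.1 h2, Complex.norm_real, Complex.ofReal_re]

/-- Stability of the measurement map from bounds on a net. -/
theorem isStable_of_net {A : Fin m → Matrix (Fin n) (Fin n) ℂ} (hA : ∀ k, (A k).IsHermitian)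
    (hm : 0 < m) {s : Finset (EuclideanSpace ℂ (Fin n))} (hs : ∀ x ∈ s, ‖x‖ ≤ 1)
    (hnet : ∀ x : EuclideanSpace ℂ (Fin n), ‖x‖ ≤ 1 → ∃ y ∈ s, ‖x - y‖ ≤ 1 / 64)
    (h : ∀ u ∈ s, ∀ v ∈ s, √m / 3 * ‖symmOuter u v‖ ≤ ‖traceMap A (symmOuter u v)‖ ∧
      ‖traceMap A (symmOuter u v)‖ ≤ 2 * √m * ‖symmOuter u v‖) :
    IsStable A (1 / 20 * √m) (6 * √m) := by
  have hm' : (0 : ℝ) < √m := by positivity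
  refine ⟨by positivity, by gcongr; norm_num, fun x y => ?_⟩
  obtain ⟨z, w, hD, hzw⟩ := exists_outerDiff_eq_symmOuter x y
  rw [norm_measurementMap_sub hA, outerDist_eq_norm, hD]
  have := norm_bounds_of_net (symmOuterL n) norm_symmOuterL_le (traceMap A) hm'.le hs hnet
    (by simpa using h) z w (by simpa using hzw)
  simp only [symmOuterL_apply] at this
  refine ⟨le_trans (le_of_eq (by ring)) this.1, this.2⟩

end TraceMap

/-! ### Law of the measurements and the union bound. -/

section TraceLaw

variable {n m : ℕ}

/-- Sum of a symmetric function over pairs, in terms of the pairs on or above the diagonal. -/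
theorem sum_sum_eq_sum_upper {f : Fin n → Fin n → ℝ} (hf : ∀ i j, f j i = f i j) :
    ∑ i, ∑ j, f i j = ∑ p : {p : Fin n × Fin n // p.1 ≤ p.2},
      (if p.1.1 = p.1.2 then 1 else 2) * f p.1.1 p.1.2 := by
  let g : Fin n → Fin n → ℝ := fun i j => if i ≤ j then (if i = j then 1 else 2) * f i j else 0
  have h1 : ∑ p : {p : Fin n × Fin n // p.1 ≤ p.2},
      (if p.1.1 = p.1.2 then 1 else 2) * f p.1.1 p.1.2 = ∑ i, ∑ j, g i j := by
    rw [← Fintype.sum_prod_type' g, ← Finset.sum_filter]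
    exact (Finset.sum_subtype (p := fun p : Fin n × Fin n => p.1 ≤ p.2) _ (by simp)
      (fun p => (if p.1 = p.2 then 1 else 2) * f p.1 p.2)).symm
  have h2 : ∑ i, ∑ j, (g i j + g j i) = ∑ i, ∑ j, 2 * f i j := by
    refine Finset.sum_congr rfl fun i _ => Finset.sum_congr rfl fun j _ => ?_
    rcases lt_trichotomy i j with h | rfl | h
    · simp [g, h.le, h.not_ge, h.ne]
    · simp [g]; ring
    · simp [g, h.le, h.not_ge, h.ne, hf]
  simp only [Finset.sum_add_distrib, ← Finset.mul_sum] at h2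
  rw [Finset.sum_comm (f := fun i j => g j i)] at h2
  rw [h1]
  linarith

variable {Ω : Type*} [MeasurableSpace Ω] {μ : Measure Ω}

theorem hasLaw_re_mul_of_realGaussian {Y : Ω → ℂ} (hY : HasLaw Y realGaussianLaw μ) {x : ℂ}
    (hx : x.im = 0) :
    HasLaw (fun ω => (Y ω * x).re) (gaussianReal 0 (‖x‖₊ ^ 2)) μ := by
  have h : HasLaw (fun z : ℂ => (z * x).re) (gaussianReal 0 (‖x‖₊ ^ 2)) realGaussianLaw := by
    refine ⟨by fun_prop, ?_⟩
    rw [realGaussianLaw, Measure.map_map (by fun_prop) (by fun_prop)]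
    have h1 : (fun z : ℂ => (z * x).re) ∘ (fun t : ℝ => (t : ℂ)) = fun t => x.re * t := by
      ext t
      simp [mul_comm]
    rw [h1, gaussianReal_map_const_mul]
    congr 1
    · simp
    · ext
      simp only [mul_one, NNReal.coe_pow, coe_nnnorm, NNReal.coe_mk,
        ← Complex.normSq_eq_norm_sq, Complex.normSq_apply, hx]
      ring
  exact h.fun_comp hY

/-- The factor `2` merges an off-diagonal entry with its conjugate. The variance `4 * (1/2) * ‖x‖²`
is the share of both positions in `‖X‖²`. -/
theorem hasLaw_re_mul_of_complexGaussian {Y : Ω → ℂ} (hY : HasLaw Y complexGaussianLaw μ) (x : ℂ) :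
    HasLaw (fun ω => 2 * (Y ω * x).re) (gaussianReal 0 (2 * ‖x‖₊ ^ 2)) μ := by
  have h : HasLaw (fun z : ℂ => 2 * (z * x).re) (gaussianReal 0 (2 * ‖x‖₊ ^ 2))
      complexGaussianLaw := by
    refine ⟨by fun_prop, ?_⟩
    rw [complexGaussianLaw, Measure.map_map (by fun_prop) (by fun_prop)]
    have h1 : (fun z : ℂ => 2 * (z * x).re) ∘
        (fun p : ℝ × ℝ => (p.1 : ℂ) + (p.2 : ℂ) * Complex.I) =
        (fun p : ℝ × ℝ => (2 * x.re) * p.1) + fun p : ℝ × ℝ => (-2 * x.im) * p.2 := by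
      ext p
      simp
      ring
    have hf : HasLaw (fun p : ℝ × ℝ => p.1) (gaussianReal 0 (1 / 2))
        ((gaussianReal 0 (1 / 2)).prod (gaussianReal 0 (1 / 2))) :=
      measurePreserving_fst.hasLaw
    have hs : HasLaw (fun p : ℝ × ℝ => p.2) (gaussianReal 0 (1 / 2))
        ((gaussianReal 0 (1 / 2)).prod (gaussianReal 0 (1 / 2))) :=
      measurePreserving_snd.hasLaw
    rw [h1, gaussianReal_add_gaussianReal_of_indepFun
      (indepFun_prod (X := fun t => (2 * x.re) * t) (Y := fun t => (-2 * x.im) * t)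
        (by fun_prop) (by fun_prop))
      (gaussianReal_const_mul hf _).map_eq (gaussianReal_const_mul hs _).map_eq]
    congr 1
    · simp
    · ext
      simp only [NNReal.coe_add, NNReal.coe_mul, NNReal.coe_mk, NNReal.coe_pow, coe_nnnorm,
        NNReal.coe_div, NNReal.coe_one, NNReal.coe_ofNat, ← Complex.normSq_eq_norm_sq,
        Complex.normSq_apply]
      ring
  exact h.fun_comp hY

/-- The functionals `Re tr (A_k X)` are independent centred Gaussians of variance `‖X‖²`. -/
theorem traceRe_gaussian {A : Fin m → Ω → Matrix (Fin n) (Fin n) ℂ}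
    (hA : IsHermitianGaussianFamily A μ) {X : EuclideanSpace ℂ (Fin n × Fin n)}
    (hX : ∀ i j, X (j, i) = conj (X (i, j))) :
    iIndepFun (fun k ω => traceRe (A k ω) X) μ ∧
      ∀ k, HasLaw (fun ω => traceRe (A k ω) X) (gaussianReal 0 (‖X‖₊ ^ 2)) μ := by
  let W : Fin m × {p : Fin n × Fin n // p.1 ≤ p.2} → Ω → ℝ := fun q ω =>
    (if q.2.1.1 = q.2.1.2 then 1 else 2) * (A q.1 ω q.2.1.1 q.2.1.2 * X (q.2.1.2, q.2.1.1)).re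
  let v : {p : Fin n × Fin n // p.1 ≤ p.2} → ℝ≥0 := fun p =>
    (if p.1.1 = p.1.2 then 1 else 2) * ‖X p.1‖₊ ^ 2
  have hWind : iIndepFun W μ :=
    hA.indep.comp (fun q (z : ℂ) => (if q.2.1.1 = q.2.1.2 then (1 : ℝ) else 2) *
      (z * X (q.2.1.2, q.2.1.1)).re) (fun q => by fun_prop)
  have hWlaw : ∀ q, HasLaw (W q) (gaussianReal 0 (v q.2)) μ := by
    rintro ⟨k, ⟨⟨i, j⟩, hij⟩⟩
    rcases eq_or_lt_of_le hij with h | h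
    · obtain rfl : i = j := h
      have him : (X (i, i)).im = 0 := by
        have := congrArg Complex.im (hX i i)
        rw [Complex.conj_im] at this
        linarith
      simpa [W, v] using hasLaw_re_mul_of_realGaussian (hA.hasLaw_diag k i) him
    · have h' : i < j := h
      have hn : ‖X (i, j)‖₊ = ‖X (j, i)‖₊ := by
        ext
        simp [hX i j]
      simpa [W, v, h'.ne, hn] using
        hasLaw_re_mul_of_complexGaussian (hA.hasLaw_offDiag k i j h') (X (j, i))
  have hsum : ∀ k ω, traceRe (A k ω) X = ∑ p, W (k, p) ω := by
    intro k ω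
    refine sum_sum_eq_sum_upper fun i j => ?_
    have h3 : A k ω j i = conj (A k ω i j) := ((hA.isHermitian k ω).apply j i).symm
    rw [h3, hX j i, ← map_mul, Complex.conj_re]
  have hv : ∑ p, v p = ‖X‖₊ ^ 2 := by
    ext
    push_cast
    rw [EuclideanSpace.norm_sq_eq, Fintype.sum_prod_type,
      sum_sum_eq_sum_upper (fun i j => by rw [hX i j, Complex.norm_conj])]
    refine Finset.sum_congr rfl fun p _ => ?_
    simp only [v]
    split_ifs <;> simp
  simp only [hsum]
  refine ⟨iIndepFun_row_sums hWind fun q => (hWlaw q).hasGaussianLaw, fun k => ?_⟩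
  rw [← hv]
  exact hasLaw_sum_gaussianReal
    (hWind.precomp (g := fun p => (k, p)) fun p q h => (Prod.mk.inj h).2) fun p => hWlaw (k, p)

/-- For a fixed Hermitian `X` the measurements concentrate around `√m ‖X‖`. -/
theorem measureReal_traceMap_bad_le [IsFiniteMeasure μ]
    {A : Fin m → Ω → Matrix (Fin n) (Fin n) ℂ}
    (hA : IsHermitianGaussianFamily A μ) {X : EuclideanSpace ℂ (Fin n × Fin n)}
    (hX : ∀ i j, X (j, i) = conj (X (i, j))) :
    μ.real {ω | ¬ (√m / 3 * ‖X‖ ≤ ‖traceMap (A · ω) X‖ ∧ ‖traceMap (A · ω) X‖ ≤ 2 * √m * ‖X‖)} ≤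
      2 * Real.exp (-1 / 2) ^ m := by
  -- The chi-square bounds need positive variance; for `X = 0` the bad event is empty.
  rcases eq_or_ne X 0 with rfl | hX0
  · simp
    positivity
  obtain ⟨hind, hlaw⟩ := traceRe_gaussian hA hX
  have hv : ‖X‖₊ ^ 2 ≠ 0 := by simpa using hX0
  have h1 := measureReal_sum_sq_ge_le hind hlaw hv
  have h2 := measureReal_sum_sq_le_le hind hlaw hv
  refine le_trans (le_trans (measureReal_mono ?_ (measure_ne_top _ _)) (measureReal_union_le _ _))
    ((add_le_add h1 h2).trans_eq (two_mul _).symm)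
  intro ω hω
  simp only [Set.mem_ofPred_eq, Set.mem_union, NNReal.coe_pow, coe_nnnorm] at hω ⊢
  rw [← norm_sq_traceMap (A · ω) X]
  by_contra! hcon
  refine hω ⟨le_of_sq_le_sq ?_ (norm_nonneg _), le_of_sq_le_sq ?_ (by positivity)⟩
  · rw [mul_pow, div_pow, Real.sq_sqrt (Nat.cast_nonneg m)]
    linarith [hcon.2]
  · rw [mul_pow, mul_pow, Real.sq_sqrt (Nat.cast_nonneg m)]
    linarith [hcon.1]

/-- Union bound over pairs of points of a finite set. -/
theorem measureReal_exists_bad_le [IsFiniteMeasure μ] {A : Fin m → Ω → Matrix (Fin n) (Fin n) ℂ}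
    (hA : IsHermitianGaussianFamily A μ) (s : Finset (EuclideanSpace ℂ (Fin n))) :
    μ.real {ω | ¬ ∀ u ∈ s, ∀ v ∈ s,
      √m / 3 * ‖symmOuter u v‖ ≤ ‖traceMap (A · ω) (symmOuter u v)‖ ∧
      ‖traceMap (A · ω) (symmOuter u v)‖ ≤ 2 * √m * ‖symmOuter u v‖} ≤
      (s.card : ℝ) ^ 2 * (2 * Real.exp (-1 / 2) ^ m) := by
  calc
    _ ≤ μ.real (⋃ q ∈ s ×ˢ s, {ω | ¬ (√m / 3 * ‖symmOuter q.1 q.2‖ ≤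
          ‖traceMap (A · ω) (symmOuter q.1 q.2)‖ ∧
          ‖traceMap (A · ω) (symmOuter q.1 q.2)‖ ≤ 2 * √m * ‖symmOuter q.1 q.2‖)}) := by
        refine measureReal_mono (fun ω hω => ?_) (measure_ne_top _ _)
        rw [Set.mem_ofPred_eq] at hω
        push Not at hω
        obtain ⟨u, hu, v, hv, h⟩ := hω
        refine Set.mem_iUnion₂.2 ⟨(u, v), Finset.mk_mem_product hu hv, ?_⟩
        rw [Set.mem_ofPred_eq, not_and, not_le]
        exact h
    _ ≤ ∑ q ∈ s ×ˢ s, μ.real {ω | ¬ (√m / 3 * ‖symmOuter q.1 q.2‖ ≤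
          ‖traceMap (A · ω) (symmOuter q.1 q.2)‖ ∧
          ‖traceMap (A · ω) (symmOuter q.1 q.2)‖ ≤ 2 * √m * ‖symmOuter q.1 q.2‖)} :=
        measureReal_biUnion_finset_le _ _
    _ ≤ ∑ q ∈ s ×ˢ s, 2 * Real.exp (-1 / 2) ^ m :=
        Finset.sum_le_sum fun q _ => measureReal_traceMap_bad_le hA (symmOuter_conj q.1 q.2)
    _ = _ := by
        rw [Finset.sum_const, Finset.card_product, nsmul_eq_mul]
        push_cast
        ring

/-- Stability with high probability, with explicit constants. -/
theorem one_sub_le_measureReal_isStable [IsProbabilityMeasure μ] {ξ : ℝ} (hξ0 : 0 < ξ) (hξ1 : ξ < 1)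
    (hm : 0 < m) (hnm : -2 * Real.log (ξ / (2 * 129 ^ 4)) * n < m)
    {A : Fin m → Ω → Matrix (Fin n) (Fin n) ℂ} (hA : IsHermitianGaussianFamily A μ) :
    1 - ξ ≤ μ.real {ω : Ω | IsStable (fun k => A k ω) (1 / 20 * √m) (6 * √m)} := by
  have hq : 0 < ξ / (2 * 129 ^ 4) := by positivity
  -- For `n = 0` the union bound gives only `2`, but all distances vanish and stability is
  -- automatic.
  rcases Nat.eq_zero_or_pos n with rfl | hn
  · have hall : {ω : Ω | IsStable (fun k => A k ω) (1 / 20 * √m) (6 * √m)} = Set.univ := by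
      refine Set.eq_univ_of_forall fun ω => ?_
      have hm' : (0 : ℝ) < √m := by positivity
      refine ⟨by positivity, by gcongr; norm_num, fun x y => ?_⟩
      have h0 : outerDiff y y = 0 := by ext p; simp [outerDiff]
      rw [Subsingleton.elim x y, outerDist_eq_norm, h0]
      simp
    rw [hall, probReal_univ]
    linarith
  obtain ⟨s, hs, hnet, hcard⟩ := exists_finset_net_unitBall
    (E := EuclideanSpace ℂ (Fin n)) (ε := 1 / 64) (by norm_num)
  -- Here `129 = 1 + 2 / (1/64)`; the exponent `4n` is the real dimension `2n`, doubled for pairs.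
  have hcard' : (s.card : ℝ) ^ 2 ≤ (129 ^ 4) ^ n := by
    have hdim : Module.finrank ℝ (EuclideanSpace ℂ (Fin n)) = 2 * n := by
      rw [finrank_real_of_complex, finrank_euclideanSpace_fin]
    rw [hdim] at hcard
    calc (s.card : ℝ) ^ 2 ≤ ((1 + 2 / (1 / 64)) ^ (2 * n)) ^ 2 := by gcongr
      _ = (129 ^ 4) ^ n := by
        rw [← pow_mul, ← pow_mul]
        congr 1
        · norm_num
        · ring
  -- The constant in `hnm` is chosen for this: the power of `129 ^ 4` cancels the number of pairs,
  -- leaving `2 (ξ/2)^n`.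
  have hexp : Real.exp (-1 / 2) ^ m ≤ (ξ / (2 * 129 ^ 4)) ^ n := by
    rw [← Real.exp_log hq, ← Real.exp_nat_mul, ← Real.exp_nat_mul, Real.exp_le_exp]
    linarith
  have hbad := (measureReal_exists_bad_le hA s).trans (b := (s.card : ℝ) ^ 2 * _) (c := ξ) (by
    calc (s.card : ℝ) ^ 2 * (2 * Real.exp (-1 / 2) ^ m)
        ≤ (129 ^ 4) ^ n * (2 * (ξ / (2 * 129 ^ 4)) ^ n) := by gcongr
      _ = 2 * (ξ / 2) ^ n := by
        rw [mul_left_comm, ← mul_pow]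
        congr 2
        field_simp
      _ ≤ 2 * (ξ / 2) ^ 1 := by
        gcongr 2 * ?_
        exact pow_le_pow_of_le_one (by positivity) (by linarith) hn
      _ = ξ := by ring)
  set B := {ω | ¬ ∀ u ∈ s, ∀ v ∈ s,
      √m / 3 * ‖symmOuter u v‖ ≤ ‖traceMap (A · ω) (symmOuter u v)‖ ∧
      ‖traceMap (A · ω) (symmOuter u v)‖ ≤ 2 * √m * ‖symmOuter u v‖} with hB
  set G := {ω : Ω | IsStable (fun k => A k ω) (1 / 20 * √m) (6 * √m)}
  have hcover : (Set.univ : Set Ω) ⊆ G ∪ B := by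
    intro ω _
    by_cases h : ω ∈ B
    · exact Or.inr h
    · rw [hB, Set.mem_ofPred_eq, not_not] at h
      exact Or.inl (isStable_of_net (fun k => hA.isHermitian k ω) hm hs hnet h)
  have h1 : (1 : ℝ) ≤ μ.real G + μ.real B := by
    rw [← probReal_univ (μ := μ)]
    exact (measureReal_mono hcover (measure_ne_top _ _)).trans (measureReal_union_le _ _)
  linarith

end TraceLaw

end QuadraticFeasibility

theorem theorem1 (ξ : ℝ) (hξ : ξ ∈ Set.Ioo (0 : ℝ) 1) :
    ∃ C α β : ℝ, 0 < C ∧ 0 < α ∧ α ≤ β ∧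
      ∀ (n m : ℕ), C * (n : ℝ) < (m : ℝ) →
      ∀ {Ω : Type*} [MeasurableSpace Ω] (μ : MeasureTheory.Measure Ω)
        [MeasureTheory.IsProbabilityMeasure μ]
        (A : Fin m → Ω → Matrix (Fin n) (Fin n) ℂ),
        QuadraticFeasibility.IsHermitianGaussianFamily A μ →
        1 - ξ ≤ μ.real {ω : Ω | QuadraticFeasibility.IsStable (fun k => A k ω)
          (α * Real.sqrt m) (β * Real.sqrt m)} := by
  obtain ⟨hξ0, hξ1⟩ := hξ
  have hC : 0 < -2 * Real.log (ξ / (2 * 129 ^ 4)) := by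
    have : Real.log (ξ / (2 * 129 ^ 4)) < 0 := Real.log_neg (by positivity) (by
      rw [div_lt_one (by positivity)]; linarith)
    linarith
  refine ⟨-2 * Real.log (ξ / (2 * 129 ^ 4)), 1 / 20, 6, hC, by norm_num, by norm_num, ?_⟩
  intro n m hnm Ω _ μ _ A hA
  -- The strict inequality gives `m > 0` even when `n = 0`, as positivity of the stability constants
  -- requires.
  have hm : (0 : ℝ) < m := lt_of_le_of_lt (by positivity) hnm
  exact QuadraticFeasibility.one_sub_le_measureReal_isStable hξ0 hξ1 (by exact_mod_cast hm) hnm hA
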